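/- Let $p$ be a prime and let $R$ be a Noetherian reduced commutative ring of characteristic $p$ that is $F$-finite (i.e. $F_*R$ is a finite $R$-module). Here $F^e_*R$ denotes $R$ viewed as an $R$-module through the $e$-th iterate of Frobenius, and for an ideal $I\subseteq R$ and $\phi\in\operatorname{Hom}_R(F^e_*R,R)$ we write $\phi(F^e_*I)$ for the image of $I$ under $\phi$. Let $\mathscr C(R)=\bigoplus_{e\ge 0}\operatorname{Hom}_R(F^e_*R,R)$ be the graded (non-commutative) ring with product $\phi\cdot\psi=\phi\circ F^d_*\psi$ for $\phi$ of degree $d$, and let $\mathscr T\subseteq\mathscr C(R)$ be a graded subalgebra with $\mathscr T_0=\mathscr C(R)_0=\operatorname{Hom}_R(R,R)$. Let $\mathfrak a\subseteq R$ be an ideal, let $t>0$ be a real number, and let $R^\circ$ be the set of elements of $R$ contained in no minimal prime. Suppose that the triple $(R,\mathscr T,\mathfrak a^t)$ is non-degenerate, that is, $\mathfrak a\cap R^\circ\neq\emptyset$ and there are $e>0$ and $\phi\in\mathscr T_e$ that is non-degenerate: the localization $\phi_\eta\colon F^e_*R_\eta\to R_\eta$ is non-zero for every minimal prime $\eta$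 of $R$. Then there exists a homogeneously defined big sharp test element for $(R,\mathscr T,\mathfrak a^t)$, that is, an element $c\in\mathfrak a\cap R^\circ$ such that for every $d\in R^\circ$ there exist an integer $i>0$ and $\psi\in\mathscr T_i$ with $$c\in\psi\bigl(F^i_*\,(\mathfrak a^{\lceil t(p^i-1)\rceil}\cdot dR)\bigr).$$ -/

import Mathlib

universe u

/-- `F^e_* R`: the ring `R` itself, regarded as an `R`-module through the `e`-fold iterate of
Frobenius `r ↦ r ^ p ^ e`. -/
def FrobeniusPushforward (_p _e : ℕ) (R : Type u) : Type u := R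

namespace FrobeniusPushforward

variable (p e : ℕ) (R : Type u) [CommRing R]

instance : CommRing (FrobeniusPushforward p e R) := inferInstanceAs (CommRing R)

/-- The identity map `R → F^e_* R`, `x ↦ F^e_* x` (an isomorphism of rings, not of `R`-modules). -/
def of : R ≃+* FrobeniusPushforward p e R := RingEquiv.refl R

variable [Fact p.Prime] [CharP R p]

/-- The Frobenius structure `R → F^e_* R`, `r ↦ F^e_* (r ^ p ^ e)`. -/
noncomputable instance : Algebra R (FrobeniusPushforward p e R) :=
  ((of p e R).toRingHom.comp (iterateFrobenius R p e)).toAlgebra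

variable {R}

theorem smul_of (r x : R) : r • of p e R x = of p e R (r ^ p ^ e * x) := rfl

end FrobeniusPushforward

/-- `R` is `F`-finite: `F_* R` is a finite `R`-module. -/
def IsFFinite (p : ℕ) (R : Type u) [CommRing R] [Fact p.Prime] [CharP R p] : Prop :=
  Module.Finite R (FrobeniusPushforward p 1 R)

/-- The degree `e` part `Hom_R(F^e_* R, R)` of the algebra `𝒞(R) = ⨁ₑ Hom_R(F^e_* R, R)`. -/
abbrev CartierMap (p e : ℕ) (R : Type u) [CommRing R] [Fact p.Prime] [CharP R p] : Type u :=
  FrobeniusPushforward p e R →ₗ[R] R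

namespace CartierMap

variable {p : ℕ} {R : Type u} [CommRing R] [Fact p.Prime] [CharP R p]

/-- The product `φ · ψ = φ ∘ F^d_* ψ` of `φ` in degree `d` and `ψ` in degree `e`; on elements,
`(φ · ψ) (F^{d+e}_* x) = φ (F^d_* (ψ (F^e_* x)))`. -/
noncomputable def mul {d e : ℕ} (φ : CartierMap p d R) (ψ : CartierMap p e R) : CartierMap p (d + e) R where
  toFun x := φ (FrobeniusPushforward.of p d R
    (ψ (FrobeniusPushforward.of p e R ((FrobeniusPushforward.of p (d + e) R).symm x))))
  map_add' x y := by simp only [map_add]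
  map_smul' r x := by
    obtain ⟨x, rfl⟩ := (FrobeniusPushforward.of p (d + e) R).surjective x
    have h : FrobeniusPushforward.of p e R (r ^ p ^ (d + e) * x) =
        (r ^ p ^ d) • FrobeniusPushforward.of p e R x := by
      rw [FrobeniusPushforward.smul_of, ← pow_mul, ← pow_add]
    rw [FrobeniusPushforward.smul_of, RingEquiv.symm_apply_apply, RingEquiv.symm_apply_apply, h,
      map_smul, smul_eq_mul, ← FrobeniusPushforward.smul_of, map_smul, RingHom.id_apply]

/-- The image `φ (F^e_* I) ⊆ R` of an ideal `I` of `R`. -/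
def image {e : ℕ} (φ : CartierMap p e R) (I : Ideal R) : Set R :=
  {y | ∃ x ∈ I, φ (FrobeniusPushforward.of p e R x) = y}

/-- The localization `φ_η : (F^e_* R)_η → R_η` at a prime `η`. -/
noncomputable def localizeAtPrime {e : ℕ} (φ : CartierMap p e R) (η : Ideal R) [η.IsPrime] :
    LocalizedModule η.primeCompl (FrobeniusPushforward p e R) →ₗ[R] Localization.AtPrime η :=
  IsLocalizedModule.map η.primeCompl
    (LocalizedModule.mkLinearMap η.primeCompl (FrobeniusPushforward p e R))
    (Algebra.linearMap R (Localization.AtPrime η)) φ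

/-- `φ` is non-degenerate if its localization at every minimal prime of `R` is non-zero. -/
def IsNondegenerate {e : ℕ} (φ : CartierMap p e R) : Prop :=
  ∀ (η : Ideal R) [η.IsPrime], η ∈ minimalPrimes R → φ.localizeAtPrime η ≠ 0

end CartierMap

/-- A graded subalgebra `𝒯` of `𝒞(R) = ⨁ₑ Hom_R(F^e_* R, R)` with `𝒯₀ = 𝒞(R)₀ = Hom_R(R, R)`,
given by its homogeneous parts: additive subgroups `𝒯ₑ ⊆ Hom_R(F^e_* R, R)`, stable under the
product. (The identity lies in `𝒯₀`, as `𝒯₀` is everything.) -/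
structure CartierSubalgebra (p : ℕ) (R : Type u) [CommRing R] [Fact p.Prime] [CharP R p] where
  /-- The homogeneous part of degree `e`. -/
  part : ∀ e : ℕ, AddSubgroup (CartierMap p e R)
  part_zero : part 0 = ⊤
  mul_mem : ∀ {d e : ℕ} {φ : CartierMap p d R} {ψ : CartierMap p e R},
    φ ∈ part d → ψ ∈ part e → φ.mul ψ ∈ part (d + e)

/-- `R°`: the elements of `R` that lie in no minimal prime. -/
def minimalPrimesCompl (R : Type u) [CommRing R] : Set R :=
  {r | ∀ η ∈ minimalPrimes R, r ∉ η}

namespace CartierSubalgebra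

variable {p : ℕ} {R : Type u} [CommRing R] [Fact p.Prime] [CharP R p]

/-- The pair `(R, 𝒯)` is non-degenerate: some `𝒯ₑ` with `e > 0` has a non-degenerate element. -/
def IsNondegeneratePair (T : CartierSubalgebra p R) : Prop :=
  ∃ e : ℕ, 0 < e ∧ ∃ φ ∈ T.part e, CartierMap.IsNondegenerate φ

/-- The triple `(R, 𝒯, 𝔞^t)` is non-degenerate: the pair `(R, 𝒯)` is, and `𝔞` meets `R°`
(the exponent `t` plays no role here). -/
def IsNondegenerateTriple (T : CartierSubalgebra p R) (a : Ideal R) : Prop :=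
  T.IsNondegeneratePair ∧ ((a : Set R) ∩ minimalPrimesCompl R).Nonempty

/-- `c` is a homogeneously defined big sharp test element for `(R, 𝒯, 𝔞^t)`. -/
def IsHDBSTestElement (T : CartierSubalgebra p R) (a : Ideal R) (t : ℝ) (c : R) : Prop :=
  c ∈ (a : Set R) ∩ minimalPrimesCompl R ∧
    ∀ d ∈ minimalPrimesCompl R, ∃ i : ℕ, 0 < i ∧ ∃ ψ ∈ T.part i,
      c ∈ CartierMap.image ψ (a ^ ⌈t * ((p : ℝ) ^ i - 1)⌉₊ * Ideal.span {d})

end CartierSubalgebra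

/-! Let `f` be the map of the non-degenerate `φ` and `q = p ^ e`. Call `c` a multiplier if `c z = ∑
xᵢ f(yᵢ z)^q` for all `z`. Modulo a minimal prime, the Gram matrix of `φ` yields a nonzero one;
prime avoidance then gives a multiplier in `R°`, which may be taken in `a`.

Fix `d ∈ R°` and let `Iₙ` be the ideal `fⁿ(dR)`. Since `c Iₙ ⊆ Iₙ₊₁`, the saturations of `Iₙ` by
powers of `c` ascend, so `c^k Iₙ₊₁ ⊆ Iₙ` for some `n`, `k`. Expanding `c · c^(kq) z` for `z ∈ Iₙ`
gives `q`-th powers of elements of `Iₙ`, so a power of `c` multiplies `Iₙ` into `Iₙ²`; by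
Cayley–Hamilton some `c^m` lies in `Iₙ`. Here `m` depends on `d`, but applying `f` further brings
the exponent down to 3 (`exists_iterate_mul_eq_cube`). A factor `c^⌈t⌉` then accounts for the power
of `a`. -/

/-! ### Dual bases for functionals on finite extensions of domains -/

open Matrix in
/-- A nonzero functional on a finite extension of domains has a dual basis, up to a nonzero
multiple. -/
theorem LinearMap.exists_smul_eq_sum_of_ne_zero {A B : Type*} [CommRing A] [IsDomain A]
    [IsNoetherianRing A] [CommRing B] [IsDomain B] [Algebra A B] [Module.Finite A B]
    (hinj : Function.Injective (algebraMap A B)) (φ : B →ₗ[A] A) (hφ : φ ≠ 0) :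
    ∃ c : A, c ≠ 0 ∧ ∃ (s : Set B) (_ : Fintype s) (y : s → B),
      ∀ z, c • z = ∑ x : s, φ (y x * z) • (x : B) := by
  classical
  have hfs : FaithfulSMul A B := (faithfulSMul_iff_algebraMap_injective A B).2 hinj
  have htf : Module.IsTorsionFree A B := inferInstance
  obtain ⟨s, hs, hmax⟩ := exists_maximal_linearIndepOn A (fun x : B => x)
  have hfin : s.Finite := LinearIndependent.set_finite_of_isNoetherian (R := A) (M := B) hs
  have : Fintype s := hfin.fintype
  have hsmul (z : B) : ∃ b : A, b ≠ 0 ∧ ∃ a : s → A, b • z = ∑ i, a i • (i : B) := by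
    have key : ∃ b : A, b ≠ 0 ∧ b • z ∈ Submodule.span A (Set.range ((↑) : s → B)) := by
      rw [Subtype.range_coe]
      by_cases hz : z ∈ s
      · exact ⟨1, one_ne_zero, by simpa using Submodule.subset_span (R := A) hz⟩
      · simpa using hmax z hz
    obtain ⟨b, hb, h⟩ := key
    obtain ⟨a, ha⟩ := (Submodule.mem_span_range_iff_exists_fun A).1 h
    exact ⟨b, hb, a, ha.symm⟩
  let G : Matrix s s A := Matrix.of fun i j => φ (i * j)
  -- A kernel vector gives `y ≠ 0` with `φ(yB) = 0`. As `y` is algebraic, it divides a nonzero `r`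
  -- from `A`, whence `r φ = 0`.
  have hG : G.det ≠ 0 := by
    intro h0
    obtain ⟨v, hv, hvG⟩ := Matrix.exists_vecMul_eq_zero_iff.2 h0
    set y : B := ∑ i, v i • (i : B) with hy
    have hy0 : y ≠ 0 := by
      intro h
      exact hv (funext (Fintype.linearIndependent_iff.1 hs v h))
    have hyj (j : s) : φ (y * j) = 0 := by
      have := congrFun hvG j
      simpa [Matrix.vecMul, dotProduct, G, hy, Finset.sum_mul, map_sum] using this
    have hyz (z : B) : φ (y * z) = 0 := by
      obtain ⟨b, hb, a, ha⟩ := hsmul z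
      have : b • φ (y * z) = 0 := by
        rw [← map_smul, ← mul_smul_comm, ha, Finset.mul_sum, map_sum]
        exact Finset.sum_eq_zero fun j _ => by rw [mul_smul_comm, map_smul, hyj, smul_zero]
      exact (smul_eq_zero.1 this).resolve_left hb
    have halg : IsAlgebraic A y := (Algebra.IsIntegral.isIntegral y).isAlgebraic
    obtain ⟨r, hr, w, hw⟩ := halg.exists_nonzero_dvd (mem_nonZeroDivisors_of_ne_zero hy0)
    apply hφ
    ext z
    have : r • φ z = 0 := by
      rw [← map_smul, Algebra.smul_def, hw, mul_assoc, hyz]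
    exact (smul_eq_zero.1 this).resolve_left hr
  -- Cramer's rule: the adjugate turns the values `φ(j z)` into `det G` times the coordinates of
  -- `z`. The denominator `b` of `z` cancels at the end.
  refine ⟨G.det, hG, s, inferInstance, fun i => ∑ j, G.adjugate j i • (j : B), fun z => ?_⟩
  obtain ⟨b, hb, a, ha⟩ := hsmul z
  have hv (j : s) : b • φ (j * z) = (a ᵥ* G) j := by
    rw [← map_smul, ← mul_smul_comm, ha, Finset.mul_sum, map_sum]
    simp [Matrix.vecMul, dotProduct, G, mul_comm]
  have hdet (i : s) : G.det * a i = b * ∑ j, G.adjugate j i * φ (j * z) := by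
    have h1 : (a ᵥ* G) ᵥ* G.adjugate = G.det • a := by
      rw [Matrix.vecMul_vecMul, Matrix.mul_adjugate, Matrix.vecMul_smul, Matrix.vecMul_one]
    have h2 := congrFun h1 i
    rw [Pi.smul_apply, smul_eq_mul] at h2
    rw [← h2, Finset.mul_sum]
    simp only [Matrix.vecMul, dotProduct] at hv ⊢
    refine Finset.sum_congr rfl fun j _ => ?_
    rw [← hv, smul_eq_mul]; ring
  apply smul_right_injective B hb
  simp only
  rw [smul_comm, ha, Finset.smul_sum, Finset.smul_sum]
  refine Finset.sum_congr rfl fun i _ => ?_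
  rw [smul_smul, smul_smul, hdet, Finset.sum_mul, map_sum]
  simp only [smul_mul_assoc, map_smul, smul_eq_mul]

/-! ### Images of ideals under iterates of a `q⁻¹`-linear map -/

section InverseFrobeniusLinear

variable {R : Type*} [CommRing R] (f : R →+ R) {q : ℕ} (hf : ∀ r z, f (r ^ q * z) = r * f z)

include hf in
theorem AddMonoidHom.iterate_pow_mul (n : ℕ) (r z : R) : f^[n] (r ^ q ^ n * z) = r * f^[n] z := by
  induction n generalizing z with
  | zero => simp
  | succ n ih =>
    rw [Function.iterate_succ_apply, Function.iterate_succ_apply, pow_succ, pow_mul, hf, ih]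

/-- The image of an ideal under a `q⁻¹`-linear map. -/
def Ideal.mapInvFrobenius (J : Ideal R) : Ideal R where
  carrier := f '' J
  add_mem' := by
    rintro _ _ ⟨x, hx, rfl⟩ ⟨y, hy, rfl⟩
    exact ⟨x + y, J.add_mem hx hy, map_add f x y⟩
  zero_mem' := ⟨0, J.zero_mem, map_zero f⟩
  smul_mem' := by
    rintro r _ ⟨x, hx, rfl⟩
    exact ⟨r ^ q * x, J.mul_mem_left _ hx, hf r x⟩

theorem Ideal.mem_mapInvFrobenius {J : Ideal R} {z : R} :
    z ∈ J.mapInvFrobenius f hf ↔ ∃ x ∈ J, f x = z := Iff.rfl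

theorem Ideal.mem_iterate_mapInvFrobenius {J : Ideal R} {n : ℕ} {z : R} :
    z ∈ (Ideal.mapInvFrobenius f hf)^[n] J ↔ ∃ x ∈ J, f^[n] x = z := by
  induction n generalizing z with
  | zero => simp
  | succ n ih =>
    rw [Function.iterate_succ_apply', Ideal.mem_mapInvFrobenius]
    simp only [ih, Function.iterate_succ_apply']
    constructor
    · rintro ⟨_, ⟨x, hx, rfl⟩, rfl⟩
      exact ⟨x, hx, rfl⟩
    · rintro ⟨x, hx, rfl⟩
      exact ⟨_, ⟨x, hx, rfl⟩, rfl⟩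

/-- The ideal of all `c` such that `c z` is a sum of terms `x * f (y * z) ^ q` with `x`, `y`
independent of `z`. -/
def dualMultiplierIdeal (q : ℕ) : Ideal R :=
  (Submodule.span R (Set.range fun y z : R => f (y * z) ^ q)).comap
    (LinearMap.toSpanSingleton R (R → R) id)

theorem mem_dualMultiplierIdeal {c : R} : c ∈ dualMultiplierIdeal f q ↔
    c • (id : R → R) ∈ Submodule.span R (Set.range fun y z : R => f (y * z) ^ q) := Iff.rfl

variable {f}

theorem mul_mem_of_mem_dualMultiplierIdeal {c z : R} (hc : c ∈ dualMultiplierIdeal f q)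
    {K : Ideal R} (hK : ∀ y, f (y * z) ^ q ∈ K) : c * z ∈ K := by
  have h : ∀ g ∈ Submodule.span R (Set.range fun y z : R => f (y * z) ^ q), g z ∈ K := by
    intro g hg
    induction hg using Submodule.span_induction with
    | mem g hg => obtain ⟨y, rfl⟩ := hg; exact hK y
    | zero => exact K.zero_mem
    | add g h _ _ hg hh => exact K.add_mem hg hh
    | smul r g _ hg => exact K.mul_mem_left r hg
  exact h _ hc

include hf in
theorem exists_eq_of_mem_dualMultiplierIdeal (hq : q ≠ 0) {c : R}
    (hc : c ∈ dualMultiplierIdeal f q) : ∃ x, f x = c := by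
  -- Take `z = 1`: the terms `f(y)^q` lie in the ideal `f(R)`, because `q ≥ 1`.
  have : c * 1 ∈ Ideal.mapInvFrobenius f hf ⊤ := mul_mem_of_mem_dualMultiplierIdeal hc fun y =>
    Ideal.pow_mem_of_mem _ ((Ideal.mem_mapInvFrobenius f hf).2 ⟨_, Submodule.mem_top, rfl⟩) _ (Nat.pos_of_ne_zero hq)
  obtain ⟨x, -, hx⟩ := (Ideal.mem_mapInvFrobenius f hf).1 this
  exact ⟨x, by rw [hx, mul_one]⟩

theorem Ideal.mul_mem_iterate_mapInvFrobenius_succ (hq : q ≠ 0) {c x₀ : R} (hc : f x₀ = c)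
    (d : R) (n : ℕ) {z : R} (hz : z ∈ (Ideal.mapInvFrobenius f hf)^[n] (Ideal.span {d})) :
    c * z ∈ (Ideal.mapInvFrobenius f hf)^[n + 1] (Ideal.span {d}) := by
  obtain ⟨m, rfl⟩ := Nat.exists_eq_succ_of_ne_zero hq
  induction n generalizing z with
  | zero =>
    refine ⟨z ^ (m + 1) * x₀, ?_, by rw [hf, hc, mul_comm]⟩
    rw [pow_succ', mul_assoc]
    exact Ideal.mul_mem_right _ _ hz
  | succ n ih =>
    rw [Function.iterate_succ_apply'] at hz ⊢
    obtain ⟨w, hw, rfl⟩ := hz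
    refine ⟨c ^ (m + 1) * w, ?_, hf c w⟩
    rw [pow_succ, mul_assoc]
    exact Ideal.mul_mem_left _ _ (ih hw)

theorem Ideal.pow_mul_mem_iterate_mapInvFrobenius (hq : q ≠ 0) {c x₀ : R} (hc : f x₀ = c)
    (d : R) (n : ℕ) : c ^ n * d ∈ (Ideal.mapInvFrobenius f hf)^[n] (Ideal.span {d}) := by
  induction n with
  | zero => simp
  | succ n ih =>
    rw [pow_succ', mul_assoc]
    exact Ideal.mul_mem_iterate_mapInvFrobenius_succ hf hq hc d n ih

/-- The saturations `J n` of `I n` by powers of `c` ascend, hence stabilize; finite generation of `I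
(n + 1)` makes the exponent uniform. -/
theorem Ideal.exists_pow_mul_mem_iterate_mapInvFrobenius [IsNoetherianRing R] (hq : q ≠ 0)
    {c x₀ : R} (hc : f x₀ = c) (d : R) :
    ∃ n k : ℕ, ∀ z ∈ (Ideal.mapInvFrobenius f hf)^[n + 1] (Ideal.span {d}),
      c ^ k * z ∈ (Ideal.mapInvFrobenius f hf)^[n] (Ideal.span {d}) := by
  classical
  set I : ℕ → Ideal R := fun n => (Ideal.mapInvFrobenius f hf)^[n] (Ideal.span {d}) with hI
  let J (n : ℕ) : Ideal R :=
    { carrier := {z | ∃ k, c ^ k * z ∈ I n}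
      zero_mem' := ⟨0, by simp⟩
      add_mem' := by
        rintro x y ⟨k, hk⟩ ⟨l, hl⟩
        refine ⟨k + l, ?_⟩
        rw [show c ^ (k + l) * (x + y) = c ^ l * (c ^ k * x) + c ^ k * (c ^ l * y) by ring]
        exact (I n).add_mem ((I n).mul_mem_left _ hk) ((I n).mul_mem_left _ hl)
      smul_mem' := by
        rintro r x ⟨k, hk⟩
        refine ⟨k, ?_⟩
        rw [smul_eq_mul, mul_left_comm]
        exact (I n).mul_mem_left _ hk }
  have hJ : Monotone J := monotone_nat_of_le_succ fun n z ⟨k, hk⟩ => ⟨k + 1, by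
    rw [pow_succ', mul_assoc]
    exact Ideal.mul_mem_iterate_mapInvFrobenius_succ hf hq hc d n hk⟩
  obtain ⟨n, hn⟩ := monotone_stabilizes_iff_noetherian.2 ‹IsNoetherianRing R› ⟨J, hJ⟩
  refine ⟨n, ?_⟩
  have hle : ∀ z ∈ I (n + 1), ∃ k, c ^ k * z ∈ I n := fun z hz => by
    have h1 : z ∈ J (n + 1) := ⟨0, by simpa using hz⟩
    have h2 : J n = J (n + 1) := hn (n + 1) n.le_succ
    rw [← h2] at h1
    exact h1
  obtain ⟨s, hs⟩ := IsNoetherian.noetherian (I (n + 1))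
  choose! k hk using hle
  refine ⟨∑ z ∈ s, k z, fun z hz => ?_⟩
  change z ∈ I (n + 1) at hz
  rw [← hs] at hz
  induction hz using Submodule.span_induction with
  | mem z hz =>
    rw [← Finset.add_sum_erase s k hz, add_comm, pow_add, mul_assoc]
    exact Ideal.mul_mem_left _ _ (hk z (hs ▸ Submodule.subset_span hz))
  | zero => simp
  | add x y _ _ hx hy => rw [mul_add]; exact Ideal.add_mem _ hx hy
  | smul r x _ hx => rw [smul_eq_mul, mul_left_comm]; exact Ideal.mul_mem_left _ _ hx

/-- The determinant trick for multiplication by `b` on `I`: a monic polynomial with lower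
coefficients in `I` kills it, and evaluating at the nonzerodivisor `a` shows that `b` is a root. -/
theorem Ideal.exists_pow_mem_of_mul_mem_sq [IsNoetherianRing R] {I : Ideal R} {b a : R}
    (ha : a ∈ I) (ha' : a ∈ nonZeroDivisors R) (h : ∀ z ∈ I, b * z ∈ I ^ 2) :
    ∃ n, b ^ n ∈ I := by
  have hrange : LinearMap.range (LinearMap.lsmul R I b) ≤ I • (⊤ : Submodule R I) := by
    rintro _ ⟨z, rfl⟩
    rw [Submodule.mem_smul_top_iff, smul_eq_mul, ← sq]
    exact h z z.2
  obtain ⟨P, hP, -, hcoeff, hev⟩ :=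
    LinearMap.exists_monic_and_natDegree_eq_and_coeff_mem_pow_and_aeval_eq_zero R
      (LinearMap.lsmul R I b) I hrange
  have hb : P.eval b = 0 := by
    have h1 : Polynomial.aeval (LinearMap.lsmul R I b) P =
        algebraMap R (Module.End R I) (P.eval b) := by
      rw [show LinearMap.lsmul R I b = algebraMap R (Module.End R I) b from rfl,
        Polynomial.aeval_algebraMap_apply, Polynomial.coe_aeval_eq_eval]
    have h2 : P.eval b * a = 0 := by
      have := LinearMap.congr_fun (h1.symm.trans hev) ⟨a, ha⟩
      simpa using congrArg Subtype.val this
    exact (mul_right_mem_nonZeroDivisors_eq_zero_iff ha').1 h2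
  refine ⟨P.natDegree, ?_⟩
  rw [Polynomial.eval_eq_sum_range, Finset.sum_range_succ, hP.coeff_natDegree, one_mul] at hb
  rw [eq_neg_of_add_eq_zero_right hb]
  refine I.neg_mem (I.sum_mem fun i hi => I.mul_mem_right _ ?_)
  exact Ideal.pow_le_self (Nat.sub_ne_zero_of_lt (Finset.mem_range.1 hi)) (hcoeff i)

theorem Ideal.exists_pow_mem_iterate_mapInvFrobenius [IsNoetherianRing R] (hq : 2 ≤ q) {c d : R}
    (hc : c ∈ dualMultiplierIdeal f q) (hc' : c ∈ nonZeroDivisors R)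
    (hd : d ∈ nonZeroDivisors R) :
    ∃ n m : ℕ, c ^ m ∈ (Ideal.mapInvFrobenius f hf)^[n] (Ideal.span {d}) := by
  have hq0 : q ≠ 0 := by omega
  obtain ⟨x₀, hx₀⟩ := exists_eq_of_mem_dualMultiplierIdeal hf hq0 hc
  obtain ⟨n, k, hk⟩ := Ideal.exists_pow_mul_mem_iterate_mapInvFrobenius hf hq0 hx₀ d
  refine ⟨n, ?_⟩
  set I := (Ideal.mapInvFrobenius f hf)^[n] (Ideal.span {d}) with hI
  -- The factor `c^(kq)` passes through `f` as `c^k`, which moves `f(y z)` from the next image back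
  -- into `I`; its `q`-th power is in `I ^ 2` as `q ≥ 2`. The extra `c` is the multiplier.
  obtain ⟨m, hm⟩ := Ideal.exists_pow_mem_of_mul_mem_sq (I := I) (b := c ^ (k * q + 1))
    (Ideal.pow_mul_mem_iterate_mapInvFrobenius hf hq0 hx₀ d n) (mul_mem (pow_mem hc' n) hd)
    fun z hz => by
      have h1 : c * (c ^ (k * q) * z) ∈ I ^ 2 :=
        mul_mem_of_mem_dualMultiplierIdeal hc fun y => by
          rw [mul_left_comm, show c ^ (k * q) = (c ^ k) ^ q by rw [pow_mul], hf]
          refine Ideal.pow_le_pow_right hq (Ideal.pow_mem_pow (hk _ ?_) q)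
          rw [Function.iterate_succ_apply']
          exact ⟨_, Ideal.mul_mem_left _ y hz, rfl⟩
      rwa [pow_succ' c, mul_assoc]
  exact ⟨_, by rwa [← pow_mul] at hm⟩

-- The exponent 2 is stable: `c² = c f(x₀) = f(c^q x₀)`, and `q ≥ 2` lets `c²` be split off from
-- `c^q`.
include hf in
theorem exists_iterate_eq_sq (hq : 2 ≤ q) {c x₀ : R} (hc : f x₀ = c) (k : ℕ) :
    ∃ u, f^[k] u = c ^ 2 := by
  induction k with
  | zero => exact ⟨_, rfl⟩
  | succ k ih =>
    obtain ⟨u, hu⟩ := ih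
    obtain ⟨m, rfl⟩ := Nat.exists_eq_add_of_le hq
    refine ⟨(c ^ m * x₀) ^ (2 + m) ^ k * u, ?_⟩
    rw [Function.iterate_succ_apply', f.iterate_pow_mul hf, hu,
      show c ^ m * x₀ * c ^ 2 = c ^ (2 + m) * x₀ by ring, hf, hc, sq]

-- This removes the dependence of the exponent on `d`: `c^(q^(m+1)) u` is in the `n`-th image as
-- soon as `c^m` is, and `f^(m+1)` sends it to `c · c²`.
include hf in
theorem exists_iterate_mul_eq_cube [IsNoetherianRing R] (hq : 2 ≤ q) {c d : R}
    (hc : c ∈ dualMultiplierIdeal f q) (hc' : c ∈ nonZeroDivisors R)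
    (hd : d ∈ nonZeroDivisors R) : ∃ n : ℕ, 0 < n ∧ ∃ w, f^[n] (d * w) = c ^ 3 := by
  obtain ⟨x₀, hx₀⟩ := exists_eq_of_mem_dualMultiplierIdeal hf (by omega) hc
  obtain ⟨n, m, hm⟩ := Ideal.exists_pow_mem_iterate_mapInvFrobenius hf hq hc hc' hd
  obtain ⟨u, hu⟩ := exists_iterate_eq_sq hf hq hx₀ (m + 1)
  have hle : m ≤ q ^ (m + 1) := by
    have := Nat.lt_pow_self (n := m + 1) (show 1 < q by omega)
    omega
  have h1 : c ^ q ^ (m + 1) * u ∈ (Ideal.mapInvFrobenius f hf)^[n] (Ideal.span {d}) := by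
    rw [← Nat.sub_add_cancel hle, pow_add, mul_assoc]
    exact Ideal.mul_mem_left _ _ (Ideal.mul_mem_right _ _ hm)
  obtain ⟨x, hx, hxu⟩ := (Ideal.mem_iterate_mapInvFrobenius f hf).1 h1
  obtain ⟨w, rfl⟩ := Ideal.mem_span_singleton'.1 hx
  refine ⟨m + 1 + n, by omega, w, ?_⟩
  rw [Function.iterate_add_apply, mul_comm, hxu, f.iterate_pow_mul hf, hu]
  ring

end InverseFrobeniusLinear

/-! ### Minimal primes of reduced rings -/

theorem mem_nonZeroDivisors_of_mem_minimalPrimesCompl {R : Type*} [CommRing R] [IsReduced R]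
    {d : R} (hd : d ∈ minimalPrimesCompl R) : d ∈ nonZeroDivisors R := by
  refine mem_nonZeroDivisors_iff_right.2 fun x hx => ?_
  have : x ∈ sInf (minimalPrimes R) := Ideal.mem_sInf.2 fun {η} hη => by
    have := IsMinimalPrime.isPrime hη
    exact (this.mem_or_mem (hx ▸ η.zero_mem : x * d ∈ η)).resolve_right (hd η hη)
  rw [minimalPrimes, Ideal.sInf_minimalPrimes] at this
  exact (nilradical_eq_zero R).le this

/-- Choose `s` in all the other minimal primes but not in `η`; then `s η` lies in every minimal
prime, so it vanishes. -/
theorem Ideal.exists_notMem_forall_mul_eq_zero_of_mem_minimalPrimes {R : Type*} [CommRing R]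
    [IsNoetherianRing R] [IsReduced R] {η : Ideal R} (hη : η ∈ minimalPrimes R) :
    ∃ s ∉ η, ∀ x ∈ η, s * x = 0 := by
  classical
  have hp := IsMinimalPrime.isPrime hη
  have hfin := minimalPrimes.finite_of_isNoetherianRing R
  have hnot : ¬ (hfin.toFinset.erase η).inf id ≤ η := by
    intro h
    obtain ⟨η', h1, h2⟩ := (Ideal.IsPrime.inf_le' hp).1 h
    rw [Finset.mem_erase, Set.Finite.mem_toFinset] at h1
    have := IsMinimalPrime.isPrime h1.2
    exact h1.1 (le_antisymm h2 (hη.2 ⟨this, bot_le⟩ h2))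
  obtain ⟨s, hs, hsη⟩ := SetLike.not_le_iff_exists.1 hnot
  refine ⟨s, hsη, fun x hx => ?_⟩
  have : s * x ∈ sInf (minimalPrimes R) := Ideal.mem_sInf.2 fun {η'} hη' => by
    by_cases h : η' = η
    · exact h ▸ η.mul_mem_left s hx
    · refine η'.mul_mem_right x ?_
      exact (Finset.inf_le (f := id) (Finset.mem_erase.2 ⟨h, hfin.mem_toFinset.2 hη'⟩) :
        (hfin.toFinset.erase η).inf id ≤ η') hs
  rw [minimalPrimes, Ideal.sInf_minimalPrimes] at this
  exact (nilradical_eq_zero R).le this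

/-! ### Multipliers from `F`-finiteness and non-degeneracy -/

section Frobenius

variable {p : ℕ} [Fact p.Prime] {R : Type*} [CommRing R] [CharP R p]

theorem IsFFinite.iterateFrobenius_finite (hF : IsFFinite p R) (e : ℕ) :
    (iterateFrobenius R p e).Finite := by
  induction e with
  | zero => rw [iterateFrobenius_zero]; exact RingHom.Finite.id R
  | succ e ih =>
    rw [iterateFrobenius_add]
    exact ih.comp hF

theorem CharP.quotient_of_isPrime (p : ℕ) [Fact p.Prime] {R : Type*} [CommRing R] [CharP R p]
    (η : Ideal R) [η.IsPrime] : CharP (R ⧸ η) p :=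
  (CharP.charP_iff_prime_eq_zero Fact.out).2 (by
    rw [← map_natCast (Ideal.Quotient.mk η), CharP.cast_eq_zero, map_zero])

theorem FrobeniusPushforward.finite_quotient (hF : IsFFinite p R) (e : ℕ) (η : Ideal R)
    [CharP (R ⧸ η) p] :
    Module.Finite (R ⧸ η) (FrobeniusPushforward p e (R ⧸ η)) := by
  have h : ((iterateFrobenius (R ⧸ η) p e).comp (Ideal.Quotient.mk η)).Finite := by
    rw [show (iterateFrobenius (R ⧸ η) p e).comp (Ideal.Quotient.mk η) =
      (Ideal.Quotient.mk η).comp (iterateFrobenius R p e) from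
        RingHom.ext fun x => (map_pow (Ideal.Quotient.mk η) x (p ^ e)).symm]
    exact (RingHom.Finite.of_surjective _ Ideal.Quotient.mk_surjective).comp
      (hF.iterateFrobenius_finite e)
  exact RingHom.Finite.of_comp_finite h

theorem exists_mem_dualMultiplierIdeal_notMem [IsNoetherianRing R] [IsReduced R]
    (hF : IsFFinite p R) {e : ℕ} (f : R →+ R) (hf : ∀ r z, f (r ^ p ^ e * z) = r * f z)
    {η : Ideal R} (hη : η ∈ minimalPrimes R) {z₀ : R} (hz₀ : f z₀ ∉ η) :
    ∃ c ∈ dualMultiplierIdeal f (p ^ e), c ∉ η := by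
  have hp := IsMinimalPrime.isPrime hη
  have hchar := CharP.quotient_of_isPrime p η
  have hfinite := FrobeniusPushforward.finite_quotient hF e η
  have hdom : IsDomain (FrobeniusPushforward p e (R ⧸ η)) :=
    inferInstanceAs (IsDomain (R ⧸ η))
  have hq : p ^ e ≠ 0 := pow_ne_zero e (Fact.out : p.Prime).ne_zero
  obtain ⟨s, hs, hsη⟩ := Ideal.exists_notMem_forall_mul_eq_zero_of_mem_minimalPrimes hη
  -- Since `s f(z) = f(s^q z) = 0` with `s ∉ η`, the map `f` descends to the domain `R ⧸ η`.
  have hfη (z : R) (hz : z ∈ η) : f z ∈ η := by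
    have : s * f z = 0 := by
      rw [← hf, ← Nat.succ_pred_eq_of_ne_zero hq, pow_succ, mul_assoc, hsη z hz, mul_zero,
        map_zero]
    exact (hp.mem_or_mem (this ▸ η.zero_mem : s * f z ∈ η)).resolve_left hs
  let π := Ideal.Quotient.mk η
  have hπ : Function.Surjective π := Ideal.Quotient.mk_surjective
  let g (w : R ⧸ η) : R ⧸ η := π (f (Function.surjInv hπ w))
  have hg (z : R) : g (π z) = π (f z) := by
    refine Ideal.Quotient.eq.2 ?_
    rw [← map_sub]
    exact hfη _ (Ideal.Quotient.eq.1 (Function.surjInv_eq hπ (π z)))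
  let φ : FrobeniusPushforward p e (R ⧸ η) →ₗ[R ⧸ η] R ⧸ η :=
    { toFun := fun w => g ((FrobeniusPushforward.of p e _).symm w)
      map_add' := by
        intro x y
        obtain ⟨x, rfl⟩ := (FrobeniusPushforward.of p e _).surjective x
        obtain ⟨y, rfl⟩ := (FrobeniusPushforward.of p e _).surjective y
        obtain ⟨x, rfl⟩ := hπ x
        obtain ⟨y, rfl⟩ := hπ y
        simp only [map_add, RingEquiv.symm_apply_apply, hg]
        rw [← map_add π, hg, map_add, map_add]
      map_smul' := by
        intro r x
        obtain ⟨x, rfl⟩ := (FrobeniusPushforward.of p e _).surjective x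
        obtain ⟨x, rfl⟩ := hπ x
        obtain ⟨r, rfl⟩ := hπ r
        rw [FrobeniusPushforward.smul_of, RingEquiv.symm_apply_apply, RingEquiv.symm_apply_apply,
          ← map_pow π, ← map_mul π, hg, hf, hg, map_mul]
        rfl }
  have hφ (z : R) : φ (FrobeniusPushforward.of p e _ (π z)) = π (f z) := hg z
  have hφ0 : φ ≠ 0 := by
    intro h
    apply hz₀
    rw [← Ideal.Quotient.eq_zero_iff_mem, ← hφ z₀, h]
    rfl
  have hinj : Function.Injective (algebraMap (R ⧸ η) (FrobeniusPushforward p e (R ⧸ η))) :=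
    iterateFrobenius_inj (R ⧸ η) p e
  obtain ⟨c, hc, t, _, y, hy⟩ := φ.exists_smul_eq_sum_of_ne_zero hinj hφ0
  obtain ⟨c, rfl⟩ := hπ c
  let X (x : FrobeniusPushforward p e (R ⧸ η)) : R :=
    Function.surjInv hπ ((FrobeniusPushforward.of p e _).symm x)
  have hX (x) : FrobeniusPushforward.of p e _ (π (X x)) = x := by
    simp only [X]
    rw [Function.surjInv_eq hπ, RingEquiv.apply_symm_apply]
  have hcη : c ∉ η := fun h => hc (Ideal.Quotient.eq_zero_iff_mem.2 h)
  -- The scalar `c` acts on the Frobenius pushforward as `c^(p^e)`. The lifted identity holds only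
  -- modulo `η`, and `s` kills the error.
  refine ⟨s * c ^ p ^ e, ?_, fun h => (hp.mem_or_mem h).elim hs fun h =>
    hcη (hp.mem_of_pow_mem _ h)⟩
  have key (z : R) : s * c ^ p ^ e * z = ∑ x : t, (s * X x) * f (X (y x) * z) ^ p ^ e := by
    have h1 : c ^ p ^ e * z - ∑ x : t, X x * f (X (y x) * z) ^ p ^ e ∈ η := by
      rw [← Ideal.Quotient.eq]
      apply (FrobeniusPushforward.of p e _).injective
      have h2 := hy (FrobeniusPushforward.of p e _ (π z))
      rw [FrobeniusPushforward.smul_of, ← map_pow π, ← map_mul π] at h2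
      refine h2.trans ?_
      rw [map_sum, map_sum]
      refine Finset.sum_congr rfl fun x _ => ?_
      conv_lhs => rw [← hX (y x), ← hX x, ← map_mul, ← map_mul π, hφ,
        FrobeniusPushforward.smul_of, ← map_pow π, ← map_mul π, mul_comm]
    have h3 := hsη _ h1
    rw [mul_sub, sub_eq_zero, Finset.mul_sum] at h3
    simpa only [mul_assoc] using h3
  rw [mem_dualMultiplierIdeal]
  have : (s * c ^ p ^ e) • (id : R → R) =
      ∑ x : t, (s * X x) • (fun z : R => f (X (y x) * z) ^ p ^ e) := by
    ext z
    simpa using key z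
  rw [this]
  exact Submodule.sum_mem _ fun x _ => Submodule.smul_mem _ _ (Submodule.subset_span ⟨_, rfl⟩)

theorem CartierMap.IsNondegenerate.exists_notMem [IsNoetherianRing R] [IsReduced R] {e : ℕ}
    {φ : CartierMap p e R} (hφ : φ.IsNondegenerate) {η : Ideal R} (hη : η ∈ minimalPrimes R) :
    ∃ z, φ (FrobeniusPushforward.of p e R z) ∉ η := by
  by_contra! h
  have hp := IsMinimalPrime.isPrime hη
  obtain ⟨s, hs, hsη⟩ := Ideal.exists_notMem_forall_mul_eq_zero_of_mem_minimalPrimes hη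
  refine hφ η hη (IsLocalizedModule.linearMap_ext η.primeCompl
    (LocalizedModule.mkLinearMap η.primeCompl (FrobeniusPushforward p e R))
    (Algebra.linearMap R (Localization.AtPrime η)) ?_)
  ext x
  obtain ⟨x, rfl⟩ := (FrobeniusPushforward.of p e R).surjective x
  rw [LinearMap.comp_apply, CartierMap.localizeAtPrime, IsLocalizedModule.map_apply,
    LinearMap.zero_comp, LinearMap.zero_apply, Algebra.linearMap_apply,
    IsLocalization.map_eq_zero_iff η.primeCompl]
  exact ⟨⟨s, hs⟩, hsη _ (h x)⟩

/-- Prime avoidance: the multiplier ideal is contained in none of the finitely many minimal primes.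
-/
theorem exists_mem_dualMultiplierIdeal_mem_minimalPrimesCompl [IsNoetherianRing R] [IsReduced R]
    (hF : IsFFinite p R) {e : ℕ} (f : R →+ R) (hf : ∀ r z, f (r ^ p ^ e * z) = r * f z)
    (h : ∀ η ∈ minimalPrimes R, ∃ z, f z ∉ η) :
    ∃ c ∈ dualMultiplierIdeal f (p ^ e), c ∈ minimalPrimesCompl R := by
  by_contra! hc
  have hfin := minimalPrimes.finite_of_isNoetherianRing R
  have hsub : (dualMultiplierIdeal f (p ^ e) : Set R) ⊆ ⋃ η ∈ minimalPrimes R, (η : Set R) := by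
    intro c hcD
    have := hc c hcD
    simpa [minimalPrimesCompl] using this
  obtain ⟨η, hη, hle⟩ := (Ideal.subset_union_prime_finite hfin ⊥ ⊥ fun η hη _ _ =>
    IsMinimalPrime.isPrime hη).1 hsub
  obtain ⟨z, hz⟩ := h η hη
  obtain ⟨c, hcD, hcη⟩ := exists_mem_dualMultiplierIdeal_notMem hF f hf hη hz
  exact hcη (hle hcD)

/-- The additive map `x ↦ φ (F^e_* x)` of `R` underlying `φ`. -/
noncomputable def CartierMap.toAddMonoidHom {e : ℕ} (φ : CartierMap p e R) : R →+ R :=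
  (φ : FrobeniusPushforward p e R →+ R).comp
    (FrobeniusPushforward.of p e R : R →+ FrobeniusPushforward p e R)

theorem CartierMap.map_of_pow_mul {e : ℕ} (φ : CartierMap p e R) (r z : R) :
    φ (FrobeniusPushforward.of p e R (r ^ p ^ e * z)) =
      r * φ (FrobeniusPushforward.of p e R z) := by
  rw [← FrobeniusPushforward.smul_of, map_smul, smul_eq_mul]

theorem CartierSubalgebra.exists_apply_eq_iterate (T : CartierSubalgebra p R) {e : ℕ}
    (he : 0 < e) {φ : CartierMap p e R} (hφ : φ ∈ T.part e) {n : ℕ} (hn : 0 < n) :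
    ∃ i, 0 < i ∧ ∃ ψ ∈ T.part i, ∀ z,
      ψ (FrobeniusPushforward.of p i R z) = φ.toAddMonoidHom^[n] z := by
  induction n, hn using Nat.le_induction with
  | base => exact ⟨e, he, φ, hφ, fun z => rfl⟩
  | succ n _ ih =>
    obtain ⟨i, _, ψ, hψ, h⟩ := ih
    refine ⟨e + i, by omega, φ.mul ψ, T.mul_mem hφ hψ, fun z => ?_⟩
    rw [Function.iterate_succ_apply', ← h]
    rfl

end Frobenius

/-! ### The test element -/

theorem mainTheorem6 {p : ℕ} [Fact p.Prime] {R : Type u} [CommRing R] [CharP R p]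
    [IsNoetherianRing R] [IsReduced R] (hF : IsFFinite p R)
    (T : CartierSubalgebra p R) (a : Ideal R) (t : ℝ) (ht : 0 < t)
    (hT : T.IsNondegenerateTriple a) :
    ∃ c : R, T.IsHDBSTestElement a t c := by
  obtain ⟨⟨e, he, φ, hφT, hφ⟩, a₀, ha₀, ha₀'⟩ := hT
  have hf := φ.map_of_pow_mul
  obtain ⟨b, hb, hb'⟩ := exists_mem_dualMultiplierIdeal_mem_minimalPrimesCompl hF
    φ.toAddMonoidHom hf fun η hη => hφ.exists_notMem hη
  set c := b * a₀ with hc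
  have hcD : c ∈ dualMultiplierIdeal φ.toAddMonoidHom (p ^ e) := Ideal.mul_mem_right _ _ hb
  have hca : c ∈ a := Ideal.mul_mem_left _ _ ha₀
  have hc' : c ∈ minimalPrimesCompl R := fun η hη h =>
    ((IsMinimalPrime.isPrime hη).mem_or_mem h).elim (hb' η hη) (ha₀' η hη)
  have hq : 2 ≤ p ^ e := (Fact.out : p.Prime).two_le.trans (Nat.le_self_pow he.ne' p)
  -- `c ^ 3` comes from `dR`. The factor `c^⌈t⌉` enters `ψ` as `c^(⌈t⌉ p^i)`, and `⌈t⌉ p^i ≥ t (p^i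
  -- - 1)`.
  refine ⟨c ^ (⌈t⌉₊ + 3), ⟨Ideal.pow_mem_of_mem a hca _ (by omega), fun η hη h =>
    hc' η hη ((IsMinimalPrime.isPrime hη).mem_of_pow_mem _ h)⟩, fun d hd => ?_⟩
  obtain ⟨n, hn, w, hw⟩ := exists_iterate_mul_eq_cube hf hq hcD
    (mem_nonZeroDivisors_of_mem_minimalPrimesCompl hc')
    (mem_nonZeroDivisors_of_mem_minimalPrimesCompl hd)
  obtain ⟨i, hi, ψ, hψ, h⟩ := T.exists_apply_eq_iterate he hφT hn
  refine ⟨i, hi, ψ, hψ, (c ^ ⌈t⌉₊) ^ p ^ i * (d * w), ?_, ?_⟩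
  · refine Ideal.mul_mem_mul ?_ (Ideal.mem_span_singleton'.2 ⟨w, mul_comm w d⟩)
    rw [← pow_mul]
    refine Ideal.pow_le_pow_right (Nat.ceil_le.2 ?_) (Ideal.pow_mem_pow hca _)
    push_cast
    have h1 : (0 : ℝ) ≤ (p : ℝ) ^ i := by positivity
    nlinarith [mul_le_mul_of_nonneg_right (Nat.le_ceil t) h1]
  · rw [ψ.map_of_pow_mul, h, hw, ← pow_add]
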